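/- Let $\mathbb T=\mathbb R/\mathbb Z$ and $\mathbb T^2=\mathbb T\times\mathbb T$. Let $f:\mathbb T^2\to\mathbb T^2$ be a quasiperiodically forced circle homeomorphism, that is, a continuous map of the form $f(\theta,\xi)=(\theta+\omega,\,f_\theta(\xi))$ with $\omega\in\mathbb R$ irrational such that every fibre map $f_\theta:\mathbb T\to\mathbb T$ is a homeomorphism, and suppose that every $f_\theta$ is orientation preserving (i.e. has a continuous strictly increasing lift $\mathbb R\to\mathbb R$). If $f$ is not homotopic to the identity map of $\mathbb T^2$, then $f$ has sensitive dependence on initial conditions on $\mathbb T^2$: there is $\varepsilon>0$ such that for all $\delta>0$ and all $x\in\mathbb T^2$ there exist $n\ge 0$ and $y\in\mathbb T^2$ with $d(x,y)<\delta$ and $d(f^n(x),f^n(y))>\varepsilon$, where $d$ is the maximum of the distances in the two circle coordinates. -/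

import Mathlib

/-- Sensitive dependence on initial conditions of a self-map `g` of a metric space `X`. -/
def SensitiveDependence {X : Type*} [MetricSpace X] (g : X → X) : Prop :=
  ∃ ε : ℝ, 0 < ε ∧ ∀ δ : ℝ, 0 < δ → ∀ x : X, ∃ (n : ℕ) (y : X),
    dist x y < δ ∧ ε < dist (g^[n] x) (g^[n] y)

/-- A self-map of the circle `ℝ/ℤ` is orientation preserving if it has a continuous, strictly
increasing lift to the real line. (This notion is only applied to circle homeomorphisms.) -/
def OrientationPreserving (h : UnitAddCircle → UnitAddCircle) : Prop :=
  ∃ H : ℝ → ℝ, Continuous H ∧ StrictMono H ∧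
    ∀ x : ℝ, ((H x : ℝ) : UnitAddCircle) = h (x : UnitAddCircle)

/-- The fibre map `f_θ : ξ ↦ π₂ (f (θ, ξ))`. -/
def fiberMap (f : UnitAddCircle × UnitAddCircle → UnitAddCircle × UnitAddCircle)
    (θ : UnitAddCircle) : UnitAddCircle → UnitAddCircle :=
  fun ξ => (f (θ, ξ)).2

/-- `f` is a quasiperiodically forced circle homeomorphism with (irrational) forcing frequency `ω`:
a continuous map of the two-torus of the form `(θ, ξ) ↦ (θ + ω, f_θ ξ)`, all of whose fibre maps
are homeomorphisms of the circle. -/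
structure IsQPFCircleHomeo (ω : ℝ)
    (f : C(UnitAddCircle × UnitAddCircle, UnitAddCircle × UnitAddCircle)) : Prop where
  irrational : Irrational ω
  fst_apply : ∀ θ ξ : UnitAddCircle, (f (θ, ξ)).1 = θ + (ω : UnitAddCircle)
  isHomeomorph_fiberMap : ∀ θ : UnitAddCircle, IsHomeomorph (fiberMap f θ)

/-!
Lift the second coordinate of `f` to a continuous map `F : ℝ → ℝ → ℝ`. Since the fibre maps are
orientation-preserving homeomorphisms, every `F t` is strictly increasing and commutes with integer
translations, and there is an integer `k`, the degree of the forcing, with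
`F (t + 1) x = F t x + k`. If `k = 0`, then `F t x - x` descends to the torus, and rescaling
this displacement together with the rotation of the base is a homotopy from `f` to the
identity (`homotopic_id_of_degree_eq_zero`). So `k ≠ 0`.

The lift of `fⁿ` turns the horizontal segment `[0, 1] × {0}` into a curve whose height changes by
exactly `n * k`, which is unbounded in `n`. Suppose that sensitivity fails. Then the lifts of
all iterates vary by at most `1 / 4` along one short horizontal segment centred at some `(t₀, x₀)`.
The forward orbit of the irrational rotation is dense, so every short interval of the base is, up to
an integer, a forward translate of a piece of that segment; as the fibre maps are monotone of
degree one, replacing one starting height by another one costs only a bounded amount. Hence the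
heights of the iterates vary by at most a constant, independent of `n`, over every short interval
(`abs_skewIter_sub_le_of_stable`). Cutting `[0, 1]` into finitely many short intervals bounds
`n * k` uniformly in `n`, which contradicts `k ≠ 0` (`degree_eq_zero_of_stable`).
-/

/-! ### Skew products over a translation of the line -/

/-- The fibre part of the `n`-th iterate of the skew product `(t, x) ↦ (t + ω, F t x)`. -/
def skewIter (ω : ℝ) (F : ℝ → ℝ → ℝ) : ℕ → ℝ → ℝ → ℝ
  | 0, _, x => x
  | n + 1, t, x => F (t + n * ω) (skewIter ω F n t x)

lemma skewIter_add (ω : ℝ) (F : ℝ → ℝ → ℝ) (n j : ℕ) (t x : ℝ) :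
    skewIter ω F (n + j) t x = skewIter ω F n (t + j * ω) (skewIter ω F j t x) := by
  induction n with
  | zero => simp [skewIter]
  | succ n ih =>
    rw [Nat.add_right_comm]
    simp only [skewIter, ih]
    congr 1
    push_cast
    ring

lemma continuous_skewIter {ω : ℝ} {F : ℝ → ℝ → ℝ} (hF : Continuous fun p : ℝ × ℝ => F p.1 p.2)
    (n : ℕ) (x : ℝ) : Continuous fun t => skewIter ω F n t x := by
  induction n with
  | zero => exact continuous_const
  | succ n ih =>
    exact hF.comp ((continuous_id.add continuous_const).prodMk ih)

lemma monotone_skewIter {ω : ℝ} {F : ℝ → ℝ → ℝ} (hF : ∀ t, Monotone (F t)) (n : ℕ) (t : ℝ) :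
    Monotone (skewIter ω F n t) := by
  induction n with
  | zero => exact monotone_id
  | succ n ih => exact (hF _).comp ih

/-- The integer translation behaviour of the iterates: the degree `k` of the dependence on the base
is multiplied by `n`. -/
lemma skewIter_add_int {ω : ℝ} {F : ℝ → ℝ → ℝ} {k : ℤ}
    (hF : ∀ (t x : ℝ) (m q : ℤ), F (t + m) (x + q) = F t x + (k * m + q))
    (n : ℕ) (t x : ℝ) (m q : ℤ) :
    skewIter ω F n (t + m) (x + q) = skewIter ω F n t x + (n * k * m + q) := by
  induction n with
  | zero => simp [skewIter]
  | succ n ih =>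
    simp only [skewIter, ih]
    have := hF (t + n * ω) (skewIter ω F n t x) m (n * k * m + q)
    push_cast at this
    rw [add_right_comm t, this]
    push_cast
    ring

/-- The forward orbit of an irrational rotation, seen on the line. -/
lemma Irrational.exists_nat_int_abs_lt {ω : ℝ} (hω : Irrational ω) (a : ℝ) {δ : ℝ} (hδ : 0 < δ) :
    ∃ (j : ℕ) (m : ℤ), |a - j * ω - m| < δ := by
  have hd : DenseRange fun j : ℕ => j • (ω : AddCircle (1 : ℝ)) :=
    denseRange_zsmul_iff_nsmul.1 (AddCircle.denseRange_zsmul_coe_iff.2 (by simpa using hω))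
  obtain ⟨j, hj⟩ := hd.exists_dist_lt (a : AddCircle (1 : ℝ)) hδ
  refine ⟨j, round (a - j * ω), ?_⟩
  rw [← UnitAddCircle.norm_eq]
  rw [dist_eq_norm] at hj
  simpa using hj

/-- If all iterates vary little along one horizontal segment, then they vary by a bounded amount
along every sufficiently short one. -/
lemma abs_skewIter_sub_le_of_stable {ω : ℝ} (hω : Irrational ω) {F : ℝ → ℝ → ℝ} {k : ℤ}
    (hmono : ∀ t, Monotone (F t))
    (hF : ∀ (t x : ℝ) (m q : ℤ), F (t + m) (x + q) = F t x + (k * m + q))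
    {δ t₀ x₀ : ℝ} (hδ : 0 < δ)
    (hst : ∀ (n : ℕ) (s : ℝ), |s - t₀| < δ →
      |skewIter ω F n s x₀ - skewIter ω F n t₀ x₀| ≤ 1 / 4)
    (n : ℕ) {a b : ℝ} (hab : |b - a| < δ / 2) :
    |skewIter ω F n b 0 - skewIter ω F n a 0| ≤ 4 := by
  -- Only forward translates are allowed, because nothing is known about negative times.
  obtain ⟨j, m, hjm⟩ := hω.exists_nat_int_abs_lt (a - t₀) (half_pos hδ)
  have key : ∀ c : ℝ, skewIter ω F (n + j) (c - j * ω - m) x₀ =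
      skewIter ω F n c (skewIter ω F j (c - j * ω - m) x₀) - n * k * m := by
    intro c
    rw [skewIter_add]
    have := skewIter_add_int (ω := ω) hF n (c - m) (skewIter ω F j (c - j * ω - m) x₀) m 0
    simp only [sub_add_cancel, Int.cast_zero, add_zero] at this
    rw [this, show c - j * ω - m + j * ω = c - m by ring]
    ring
  have hta : |(a - j * ω - m) - t₀| < δ := by
    rw [abs_lt] at hjm ⊢
    constructor <;> linarith
  have htb : |(b - j * ω - m) - t₀| < δ := by
    rw [abs_lt] at hjm hab ⊢
    constructor <;> linarith
  have h1 := hst j _ hta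
  have h2 := hst j _ htb
  have h3 := hst (n + j) _ hta
  have h4 := hst (n + j) _ htb
  rw [key a] at h3
  rw [key b] at h4
  set y := skewIter ω F j (a - j * ω - m) x₀
  set z := skewIter ω F j (b - j * ω - m) x₀
  have hp1 := Int.floor_le y
  have hp2 := (Int.lt_floor_add_one y).le
  set p := ⌊y⌋
  have shift : ∀ (c : ℝ) (q : ℤ), skewIter ω F n c q = skewIter ω F n c 0 + q := by
    intro c q
    simpa using skewIter_add_int (ω := ω) hF n c 0 0 q
  rw [abs_le] at h1 h2 h3 h4
  have ha1 := monotone_skewIter (ω := ω) hmono n a hp1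
  have ha2 := monotone_skewIter (ω := ω) hmono n a
    (show y ≤ ((p + 1 : ℤ) : ℝ) by push_cast; linarith)
  have hb1 := monotone_skewIter (ω := ω) hmono n b
    (show ((p - 1 : ℤ) : ℝ) ≤ z by push_cast; linarith)
  have hb2 := monotone_skewIter (ω := ω) hmono n b
    (show z ≤ ((p + 2 : ℤ) : ℝ) by push_cast; linarith)
  rw [shift] at ha1 ha2 hb1 hb2
  push_cast at ha1 ha2 hb1 hb2
  rw [abs_le]
  constructor <;> linarith

lemma degree_eq_zero_of_stable {ω : ℝ} (hω : Irrational ω) {F : ℝ → ℝ → ℝ} {k : ℤ}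
    (hmono : ∀ t, Monotone (F t))
    (hF : ∀ (t x : ℝ) (m q : ℤ), F (t + m) (x + q) = F t x + (k * m + q))
    {δ t₀ x₀ : ℝ} (hδ : 0 < δ)
    (hst : ∀ (n : ℕ) (s : ℝ), |s - t₀| < δ →
      |skewIter ω F n s x₀ - skewIter ω F n t₀ x₀| ≤ 1 / 4) :
    k = 0 := by
  obtain ⟨N, hN⟩ := exists_nat_one_div_lt (half_pos hδ)
  have hN0 : (0 : ℝ) < N + 1 := by positivity
  have tele : ∀ n i : ℕ,
      |skewIter ω F n (i / (N + 1)) 0 - skewIter ω F n 0 0| ≤ 4 * i := by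
    intro n i
    induction i with
    | zero => simp
    | succ i ih =>
      have hstep := abs_skewIter_sub_le_of_stable hω hmono hF hδ hst n
        (a := i / (N + 1)) (b := (i + 1 : ℕ) / (N + 1)) (by
          rw [← sub_div]
          push_cast
          rwa [add_sub_cancel_left, abs_of_pos (by positivity)])
      rw [abs_le] at *
      push_cast at *
      constructor <;> linarith
  have bound : ∀ n : ℕ, (n : ℝ) * |(k : ℝ)| ≤ 4 * (N + 1) := by
    intro n
    have h := tele n (N + 1)
    have h1 := skewIter_add_int (ω := ω) hF n 0 0 1 0
    push_cast at h h1
    rw [div_self hN0.ne'] at h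
    simp only [zero_add, add_zero, mul_one] at h1
    rw [h1, add_sub_cancel_left, abs_mul, Nat.abs_cast] at h
    exact h
  by_contra hk
  have hk1 : (1 : ℝ) ≤ |(k : ℝ)| := by
    exact_mod_cast Int.one_le_abs hk
  obtain ⟨n, hn⟩ := exists_nat_gt (4 * ((N : ℝ) + 1))
  nlinarith [bound n, (Nat.cast_nonneg n : (0 : ℝ) ≤ n)]

/-! ### Lifts of circle-valued maps -/

lemma exists_int_eq_add_of_coe_eq {X : Type*} [TopologicalSpace X] [PreconnectedSpace X]
    [Nonempty X] {φ ψ : X → ℝ} (hφ : Continuous φ) (hψ : Continuous ψ)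
    (h : ∀ x, (φ x : UnitAddCircle) = ψ x) : ∃ m : ℤ, ∀ x, φ x = ψ x + m := by
  obtain ⟨x₀⟩ := ‹Nonempty X›
  obtain ⟨m, hm⟩ := (AddCircle.coe_eq_zero_iff (1 : ℝ)).1
    (show ((φ x₀ - ψ x₀ : ℝ) : UnitAddCircle) = 0 by rw [AddCircle.coe_sub, h, sub_self])
  refine ⟨m, congrFun ((AddCircle.isCoveringMap_coe (1 : ℝ)).eq_of_comp_eq hφ
    (hψ.add continuous_const) ?_ x₀ ?_)⟩
  · funext x
    have hm0 : ((m : ℝ) : UnitAddCircle) = 0 :=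
      (AddCircle.coe_eq_zero_iff (1 : ℝ)).2 ⟨m, by simp⟩
    change (φ x : UnitAddCircle) = ((ψ x + m : ℝ) : UnitAddCircle)
    rw [AddCircle.coe_add, hm0, add_zero, h]
  · simp only [zsmul_eq_mul, mul_one] at hm
    simp [hm]

lemma exists_lift_of_plane {g : ℝ × ℝ → UnitAddCircle} (hg : Continuous g) :
    ∃ F : ℝ → ℝ → ℝ, (Continuous fun p : ℝ × ℝ => F p.1 p.2) ∧
      ∀ t x, (F t x : UnitAddCircle) = g (t, x) := by
  obtain ⟨e, he⟩ := QuotientAddGroup.mk_surjective (g 0)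
  obtain ⟨F, ⟨-, hF⟩, -⟩ := (AddCircle.isCoveringMap_coe (1 : ℝ)).existsUnique_continuousMap_lifts
    ⟨g, hg⟩ 0 e he
  exact ⟨fun t x => F (t, x), F.continuous, fun t x => congrFun hF (t, x)⟩

/-- A continuous circle-valued map that stays within `1 / 4` of its value at the centre of an
interval has a lift that stays within `1 / 4` as well, by connectedness of the interval. -/
lemma abs_sub_le_of_norm_coe_sub_le {φ : ℝ → ℝ} (hφ : Continuous φ) {t₀ δ : ℝ}
    (h : ∀ s, |s - t₀| < δ → ‖((φ s - φ t₀ : ℝ) : UnitAddCircle)‖ ≤ 1 / 4)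
    {s : ℝ} (hs : |s - t₀| < δ) : |φ s - φ t₀| ≤ 1 / 4 := by
  by_contra! hlt
  -- On the circle the norm agrees with the absolute value of the lift only up to `1 / 2`.
  have hmem : min |φ s - φ t₀| (1 / 2) ∈ Set.Icc |φ t₀ - φ t₀| |φ s - φ t₀| := by
    simp
  obtain ⟨r, hr, hrv⟩ := intermediate_value_uIcc (f := fun r => |φ r - φ t₀|) (a := t₀) (b := s)
    (by fun_prop) (Set.Icc_subset_uIcc hmem)
  have hrs : |r - t₀| < δ := (Set.abs_sub_left_of_mem_uIcc hr).trans_lt hs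
  have h1 := h r hrs
  simp only at hrv
  rw [(AddCircle.norm_coe_eq_abs_iff (1 : ℝ) one_ne_zero).2 (by rw [hrv]; simp), hrv] at h1
  have : (1 / 4 : ℝ) < min |φ s - φ t₀| (1 / 2) := lt_min hlt (by norm_num)
  linarith

/-- A lift of an injective circle map that is strictly increasing has degree one. -/
lemma lift_degree_eq_one {H : ℝ → ℝ} (hc : Continuous H) (hm : StrictMono H)
    {h : UnitAddCircle → UnitAddCircle} (hinj : Function.Injective h)
    (hH : ∀ x : ℝ, (H x : UnitAddCircle) = h x) {d : ℤ} (hd : ∀ x, H (x + 1) = H x + d) :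
    d = 1 := by
  have h0 := hd 0
  rw [zero_add] at h0
  have hpos : (0 : ℝ) < d := by linarith [hm (zero_lt_one (α := ℝ))]
  have hd1 : 1 ≤ d := by
    have : 0 < d := by exact_mod_cast hpos
    omega
  have hd1' : (1 : ℝ) ≤ d := by exact_mod_cast hd1
  obtain ⟨x, hx, hxv⟩ := intermediate_value_Icc (zero_le_one (α := ℝ)) hc.continuousOn
    (show H 0 + 1 ∈ Set.Icc (H 0) (H 1) from ⟨by linarith, by linarith⟩)
  have hx0 : (x : UnitAddCircle) = (0 : ℝ) := by
    apply hinj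
    rw [← hH, ← hH, hxv, AddCircle.coe_add, AddCircle.coe_period, add_zero]
  -- The value `H 0 + 1` is attained on `[0, 1]`, by injectivity only at the endpoint `1`.
  have hx1 : x = 1 := by
    by_contra hne
    have hxI : x ∈ Set.Ico (0 : ℝ) (0 + 1) :=
      ⟨hx.1, by rw [zero_add]; exact lt_of_le_of_ne hx.2 hne⟩
    have := (AddCircle.coe_eq_coe_iff_of_mem_Ico (p := (1 : ℝ)) (a := 0) hxI (by simp)).1 hx0
    rw [this] at hxv
    linarith
  rw [hx1] at hxv
  have : (d : ℝ) = 1 := by linarith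
  exact_mod_cast this

lemma add_int_mul_of_add_one {φ : ℝ → ℝ} {c : ℝ} (h : ∀ x, φ (x + 1) = φ x + c) (x : ℝ) (m : ℤ) :
    φ (x + m) = φ x + c * m := by
  induction m with
  | zero => simp
  | succ i ih =>
    push_cast at *
    rw [← add_assoc, h, ih]
    ring
  | pred i ih =>
    have := h (x + (-i - 1))
    push_cast at *
    rw [show x + (-(i : ℝ) - 1) + 1 = x + -i by ring, ih] at this
    linarith

/-- A quasiperiodically forced circle homeomorphism with orientation-preserving fibre maps has a
lift that is monotone of degree one in the fibre and of some integer degree in the base. -/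
lemma IsQPFCircleHomeo.exists_lift {ω : ℝ}
    {f : C(UnitAddCircle × UnitAddCircle, UnitAddCircle × UnitAddCircle)}
    (hf : IsQPFCircleHomeo ω f) (hor : ∀ θ : UnitAddCircle, OrientationPreserving (fiberMap f θ)) :
    ∃ (F : ℝ → ℝ → ℝ) (k : ℤ), (Continuous fun p : ℝ × ℝ => F p.1 p.2) ∧
      (∀ t x : ℝ, (F t x : UnitAddCircle) = (f ((t : UnitAddCircle), (x : UnitAddCircle))).2) ∧
      (∀ t, Monotone (F t)) ∧
      ∀ (t x : ℝ) (m q : ℤ), F (t + m) (x + q) = F t x + (k * m + q) := by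
  have hcoe : Continuous fun x : ℝ => (x : UnitAddCircle) := AddCircle.continuous_mk' 1
  obtain ⟨F, hFc, hF⟩ := exists_lift_of_plane
    (g := fun p => (f ((p.1 : UnitAddCircle), (p.2 : UnitAddCircle))).2)
    (continuous_snd.comp (f.continuous.comp
      ((hcoe.comp continuous_fst).prodMk (hcoe.comp continuous_snd))))
  have hFt : ∀ t, Continuous (F t) := fun t => hFc.comp (continuous_const.prodMk continuous_id)
  have hmono : ∀ t, StrictMono (F t) := by
    intro t
    obtain ⟨H, hHc, hHm, hH⟩ := hor t
    obtain ⟨m, hm⟩ := exists_int_eq_add_of_coe_eq (hFt t) hHc (fun x => by rw [hF, hH]; rfl)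
    intro x y hxy
    rw [hm, hm]
    have := hHm hxy
    linarith
  obtain ⟨k, hk⟩ := exists_int_eq_add_of_coe_eq (φ := fun p : ℝ × ℝ => F (p.1 + 1) p.2)
    (by fun_prop) hFc (fun p => by simp [hF])
  have hdeg : ∀ t x, F t (x + 1) = F t x + 1 := by
    intro t x
    obtain ⟨d, hd⟩ := exists_int_eq_add_of_coe_eq (φ := fun x => F t (x + 1)) (ψ := F t)
      ((hFt t).comp (continuous_add_const 1)) (hFt t) (fun x => by simp [hF])
    have hd1 := lift_degree_eq_one (hFt t) (hmono t) (hf.isHomeomorph_fiberMap t).injective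
      (fun x => by rw [hF]; rfl) hd
    simpa [hd1] using hd x
  refine ⟨F, k, hFc, hF, fun t => (hmono t).monotone, fun t x m q => ?_⟩
  rw [add_int_mul_of_add_one (hdeg (t + m)) x q,
    add_int_mul_of_add_one (φ := fun t => F t x) (fun t => hk (t, x)) t m]
  ring

/-! ### Maps of degree zero are homotopic to the identity -/

lemma homotopic_id_of_degree_eq_zero {ω : ℝ}
    {f : C(UnitAddCircle × UnitAddCircle, UnitAddCircle × UnitAddCircle)}
    (hfst : ∀ θ ξ : UnitAddCircle, (f (θ, ξ)).1 = θ + (ω : UnitAddCircle))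
    {F : ℝ → ℝ → ℝ} (hFc : Continuous fun p : ℝ × ℝ => F p.1 p.2)
    (hF : ∀ t x : ℝ, (F t x : UnitAddCircle) = (f ((t : UnitAddCircle), (x : UnitAddCircle))).2)
    (hper : ∀ (t x : ℝ) (m q : ℤ), F (t + m) (x + q) = F t x + q) :
    ContinuousMap.Homotopic f (ContinuousMap.id (UnitAddCircle × UnitAddCircle)) := by
  have hcoe : Continuous fun x : ℝ => (x : UnitAddCircle) := AddCircle.continuous_mk' 1
  have hq : IsOpenQuotientMap (Prod.map ((↑) : ℝ → UnitAddCircle) ((↑) : ℝ → UnitAddCircle)) :=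
    QuotientAddGroup.isOpenQuotientMap_mk.prodMap QuotientAddGroup.isOpenQuotientMap_mk
  have coe_eq : ∀ a b : ℝ, (a : UnitAddCircle) = b → ∃ m : ℤ, a = b + m := by
    intro a b h
    obtain ⟨m, hm⟩ := (AddCircle.coe_eq_zero_iff (1 : ℝ)).1
      (show ((a - b : ℝ) : UnitAddCircle) = 0 by rw [AddCircle.coe_sub, h, sub_self])
    simp only [zsmul_eq_mul, mul_one] at hm
    exact ⟨m, by linarith⟩
  -- The displacement `F t x - x`, as a real-valued function `G` on the torus.
  have hfac : Function.FactorsThrough (fun p : ℝ × ℝ => F p.1 p.2 - p.2)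
      (Prod.map ((↑) : ℝ → UnitAddCircle) ((↑) : ℝ → UnitAddCircle)) := by
    rintro ⟨a, b⟩ ⟨c, d⟩ h
    obtain ⟨m, rfl⟩ := coe_eq a c (congrArg Prod.fst h)
    obtain ⟨q, rfl⟩ := coe_eq b d (congrArg Prod.snd h)
    simp only [hper]
    ring
  let G : C(UnitAddCircle × UnitAddCircle, ℝ) :=
    Topology.IsQuotientMap.lift (f := ⟨_, hq.continuous⟩) hq.isQuotientMap
      ⟨fun p : ℝ × ℝ => F p.1 p.2 - p.2, hFc.sub continuous_snd⟩ hfac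
  have hG : ∀ t x : ℝ, G ((t : UnitAddCircle), (x : UnitAddCircle)) = F t x - x := fun t x =>
    DFunLike.congr_fun (Topology.IsQuotientMap.lift_comp (f := ⟨_, hq.continuous⟩) hq.isQuotientMap
      ⟨fun p : ℝ × ℝ => F p.1 p.2 - p.2, hFc.sub continuous_snd⟩ hfac) (t, x)
  have hfG : ∀ p, f p = (p.1 + (ω : UnitAddCircle), p.2 + (G p : UnitAddCircle)) := by
    rintro ⟨θ, ξ⟩
    obtain ⟨t, rfl⟩ := QuotientAddGroup.mk_surjective θ
    obtain ⟨x, rfl⟩ := QuotientAddGroup.mk_surjective ξ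
    refine Prod.ext (hfst _ _) ?_
    have := hG t x
    simp only
    rw [this, ← AddCircle.coe_add, add_sub_cancel, hF]
  refine ContinuousMap.Homotopic.symm ⟨⟨⟨fun z =>
    (z.2.1 + (((z.1 : ℝ) * ω : ℝ) : UnitAddCircle),
      z.2.2 + (((z.1 : ℝ) * G z.2 : ℝ) : UnitAddCircle)), ?_⟩, ?_, ?_⟩⟩
  · exact (continuous_snd.fst.add (hcoe.comp (by fun_prop))).prodMk
      (continuous_snd.snd.add (hcoe.comp (by fun_prop)))
  · intro p
    simp
  · intro p
    simp [hfG]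

/-! ### Sensitivity -/

lemma iterate_coe_eq_skewIter {ω : ℝ}
    {f : UnitAddCircle × UnitAddCircle → UnitAddCircle × UnitAddCircle}
    (hfst : ∀ θ ξ : UnitAddCircle, (f (θ, ξ)).1 = θ + (ω : UnitAddCircle)) {F : ℝ → ℝ → ℝ}
    (hF : ∀ t x : ℝ, (F t x : UnitAddCircle) = (f ((t : UnitAddCircle), (x : UnitAddCircle))).2)
    (n : ℕ) (t x : ℝ) :
    f^[n] ((t : UnitAddCircle), (x : UnitAddCircle)) =
      (((t + n * ω : ℝ) : UnitAddCircle), ((skewIter ω F n t x : ℝ) : UnitAddCircle)) := by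
  induction n with
  | zero => simp [skewIter]
  | succ n ih =>
    rw [Function.iterate_succ_apply', ih]
    refine Prod.ext ?_ (hF _ _).symm
    rw [hfst, ← AddCircle.coe_add]
    push_cast
    ring_nf

theorem mainTheorem7 (ω : ℝ)
    (f : C(UnitAddCircle × UnitAddCircle, UnitAddCircle × UnitAddCircle))
    (hf : IsQPFCircleHomeo ω f)
    (hor : ∀ θ : UnitAddCircle, OrientationPreserving (fiberMap f θ))
    (hhom : ¬ ContinuousMap.Homotopic f
      (ContinuousMap.id (UnitAddCircle × UnitAddCircle))) :
    SensitiveDependence (f : UnitAddCircle × UnitAddCircle → UnitAddCircle × UnitAddCircle) := by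
  obtain ⟨F, k, hFc, hF, hmono, hper⟩ := hf.exists_lift hor
  refine ⟨1 / 4, by norm_num, ?_⟩
  by_contra! hns
  obtain ⟨δ, hδ, ⟨θ, ξ⟩, hst⟩ := hns
  obtain ⟨t₀, rfl⟩ := QuotientAddGroup.mk_surjective θ
  obtain ⟨x₀, rfl⟩ := QuotientAddGroup.mk_surjective ξ
  have hk : k = 0 := by
    refine degree_eq_zero_of_stable hf.irrational hmono hper (t₀ := t₀) (x₀ := x₀) hδ
      fun n s hs => abs_sub_le_of_norm_coe_sub_le (continuous_skewIter hFc n x₀) ?_ hs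
    intro r hr
    have hclose : dist ((t₀ : UnitAddCircle), (x₀ : UnitAddCircle))
        ((r : UnitAddCircle), (x₀ : UnitAddCircle)) < δ := by
      rw [Prod.dist_eq, dist_self, max_lt_iff]
      refine ⟨?_, hδ⟩
      rw [dist_comm, dist_eq_norm, ← AddCircle.coe_sub]
      exact QuotientAddGroup.norm_mk_le_norm.trans_lt hr
    have := hst n _ hclose
    rw [iterate_coe_eq_skewIter hf.fst_apply hF, iterate_coe_eq_skewIter hf.fst_apply hF,
      Prod.dist_eq, max_le_iff] at this
    rw [AddCircle.coe_sub, ← dist_eq_norm, dist_comm]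
    exact this.2
  refine hhom (homotopic_id_of_degree_eq_zero hf.fst_apply hFc hF fun t x m q => ?_)
  rw [hper, hk]
  simp
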